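/- **Theorem 2.** Let $\kappa\in\mathbb{R}$ and let $(X,d)$ be a complete CAT($\kappa$) space; if $\kappa>0$, assume that $X$ has diameter less than $\frac{\pi}{2\sqrt{\kappa}}$. (CAT($\kappa$) is meant in the usual sense: any two points, at distance less than $\pi/\sqrt\kappa$ if $\kappa>0$, are joined by a geodesic, and in every geodesic triangle, of perimeter less than $2\pi/\sqrt\kappa$ if $\kappa>0$, the distance between two points is at most the distance between their comparison points in a comparison triangle in the complete simply connected surface of constant curvature $\kappa$. Under these assumptions $X$ is uniquely geodesic; for $x,y\in X$ and $t\in[0,1]$ we write $(1-t)x+ty$ for the point of the geodesic from $x$ to $y$ at distance $t\,d(x,y)$ from $x$.) Let $A\subset X$ be a bounded set with diameter $D$ such that for each point $x\in X$ there is at least one point of $A$ furthest from $x$, and define $F\colon X\to\mathbb{R}$ by $F(x)=\max_{a\in A}d(x,a)^2$. Let $N\ge 0$ be an integer, let $\Delta=\frac{1}{\sqrt{2(N+1)}}$, and let $x^0,x^1,\dots,x^N\in X$ be any sequence with $x^0\in A$ and, for each $k=0,\dots,N-1$, $$x^{k+1}=(1-\Delta)x^k+\Delta\,\bar a^k\quad\text{for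 some point }\bar a^k\in A\text{ furthest from }x^k.$$ Then $F$ attains its minimum on $X$, and $$\min_{k=0,\dots,N}F(x^k)-\min F\;\le\;\frac{2\sqrt{2}\,D^2}{\sqrt{N+1}}.$$ -/

import Mathlib

noncomputable section

open Set

/-- `γ`, restricted to `[0, d(x,y)]`, is a geodesic joining `x` to `y`. -/
def IsGeodesic {X : Type*} [MetricSpace X] (γ : ℝ → X) (x y : X) : Prop :=
  γ 0 = x ∧ γ (dist x y) = y ∧
    ∀ s ∈ Icc 0 (dist x y), ∀ t ∈ Icc 0 (dist x y), dist (γ s) (γ t) = |s - t|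

/-- `p` is a point `(1 - t) x + t y`: it lies on a geodesic joining `x` to `y`, at distance
`t d(x,y)` from `x`. In a uniquely geodesic space and for `t ∈ [0,1]` there is exactly one. -/
def IsGeodesicCombo {X : Type*} [MetricSpace X] (t : ℝ) (x y p : X) : Prop :=
  ∃ γ : ℝ → X, IsGeodesic γ x y ∧ p = γ (t * dist x y)

/-- The model plane of constant curvature `κ`, up to rescaling of the distance, as a surface in
`ℝ³`: the unit sphere if `κ > 0`, the upper sheet of the hyperboloid if `κ < 0`, and the flat
plane at height `1` if `κ = 0`. -/
def modelPlane (κ : ℝ) : Set (Fin 3 → ℝ) :=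
  {u | (0 < κ → u 0 ^ 2 + u 1 ^ 2 + u 2 ^ 2 = 1) ∧
       (κ = 0 → u 0 = 1) ∧
       (κ < 0 → -u 0 ^ 2 + u 1 ^ 2 + u 2 ^ 2 = -1 ∧ 0 < u 0)}

/-- The distance of the model plane of curvature `κ`: the angular distance of the sphere divided
by `√κ`, the Euclidean distance, or the hyperbolic distance divided by `√(-κ)`. -/
def modelDist (κ : ℝ) (u v : Fin 3 → ℝ) : ℝ :=
  if 0 < κ then Real.arccos (u 0 * v 0 + u 1 * v 1 + u 2 * v 2) / √κ
  else if κ < 0 then Real.arcosh (u 0 * v 0 - u 1 * v 1 - u 2 * v 2) / √(-κ)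
  else √((u 1 - v 1) ^ 2 + (u 2 - v 2) ^ 2)

/-- `w` is a comparison triangle in the model plane for the triangle with vertices `v`. -/
def IsComparisonTriangle {X : Type*} [MetricSpace X] (κ : ℝ) (v : Fin 3 → X)
    (w : Fin 3 → Fin 3 → ℝ) : Prop :=
  (∀ i, w i ∈ modelPlane κ) ∧ ∀ i j, modelDist κ (w i) (w j) = dist (v i) (v j)

/-- `p` is the point of the segment `[a, b]` of the model plane at distance `s` from `a`. -/
def IsModelSegmentPoint (κ : ℝ) (a b : Fin 3 → ℝ) (s : ℝ) (p : Fin 3 → ℝ) : Prop :=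
  p ∈ modelPlane κ ∧ modelDist κ a p = s ∧ modelDist κ p b = modelDist κ a b - s

/-- The CAT(`κ`) inequality for the geodesic triangle with vertices `v 0, v 1, v 2`, whose `i`-th
side is the geodesic `γ i` from `v i` to `v (i + 1)` (indices modulo 3): distances between points
of the triangle are at most the distances between their comparison points. -/
def CATInequality {X : Type*} [MetricSpace X] (κ : ℝ) (v : Fin 3 → X) (γ : Fin 3 → ℝ → X) :
    Prop :=
  ∀ w : Fin 3 → Fin 3 → ℝ, IsComparisonTriangle κ v w →
    ∀ i j : Fin 3, ∀ s ∈ Icc 0 (dist (v i) (v (i + 1))), ∀ t ∈ Icc 0 (dist (v j) (v (j + 1))),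
      ∀ p q : Fin 3 → ℝ, IsModelSegmentPoint κ (w i) (w (i + 1)) s p →
        IsModelSegmentPoint κ (w j) (w (j + 1)) t q →
          dist (γ i s) (γ j t) ≤ modelDist κ p q

/-- `X` is a CAT(`κ`) space: any two points (at distance less than `π/√κ` if `κ > 0`) are joined
by a geodesic, and every geodesic triangle (of perimeter less than `2π/√κ` if `κ > 0`) satisfies
the CAT(`κ`) inequality. -/
structure IsCATSpace (κ : ℝ) (X : Type*) [MetricSpace X] : Prop where
  exists_geodesic : ∀ x y : X, (0 < κ → dist x y < Real.pi / √κ) →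
    ∃ γ : ℝ → X, IsGeodesic γ x y
  cat_inequality : ∀ (v : Fin 3 → X) (γ : Fin 3 → ℝ → X),
    (∀ i, IsGeodesic (γ i) (v i) (v (i + 1))) →
    (0 < κ → dist (v 0) (v 1) + dist (v 1) (v 2) + dist (v 2) (v 0) < 2 * (Real.pi / √κ)) →
      CATInequality κ v γ

/-- `a` is a point of `A` furthest from `x`. -/
def IsFurthestPoint {X : Type*} [MetricSpace X] (A : Set X) (x a : X) : Prop :=
  a ∈ A ∧ ∀ b ∈ A, dist x b ≤ dist x a

/-- The objective `F(x) = max_{a ∈ A} d(x,a)²`. -/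
def enclosingObjective {X : Type*} [MetricSpace X] (A : Set X) (x : X) : ℝ :=
  sSup ((fun a => dist x a ^ 2) '' A)

/-- The points `x 0, …, x N` are generated by the algorithm with step sizes `t 0, …, t (N - 1)`:
it starts in `A`, and each step moves from the current point towards a furthest point of `A`. -/
def IsAlgorithmRun {X : Type*} [MetricSpace X] (A : Set X) (t : ℕ → ℝ) (N : ℕ) (x : ℕ → X) :
    Prop :=
  x 0 ∈ A ∧ ∀ k < N, ∃ a : X, IsFurthestPoint A (x k) a ∧ IsGeodesicCombo (t k) (x k) a (x (k + 1))

end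

open Set

/-! The squared distance to a circumcentre p of A is a potential for the algorithm. When x moves a
fraction t towards a furthest point a, `IsCATSpace.dist_sq_step_le` bounds the new d(·,p)² by
d(x,p)² - t (d(x,a)² - d(a,p)²) + t² d(x,a)². Here d(x,a)² = F(x) and d(a,p)² ≤ F(p). The iterates
stay within D of every point of A, because closed balls are convex (`IsCATSpace.dist_le_max`). So
each step lowers the potential by at least t (F(x) - F(p)) - t² D², and telescoping over N + 1 steps
bounds the best gap by D²/((N+1)t) + t D².

For κ ≤ 0 the step estimate is a weakening of the Bruhat-Tits inequality. For κ > 0 it combines two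
facts about the comparison triangle: a spherical hinge is no wider than the Euclidean one, and
d(·,a)² lies above its first-order expansion at x in the direction of y. In nonzero curvature
everything rests on the convexity of w ↦ cos √w and w ↦ cosh √w.

The circumcentre exists (`IsCATSpace.exists_dist_furthest_le`) because d² for κ ≤ 0, or -cos(√κ d)
for κ > 0, is uniformly midpoint convex, which makes minimising sequences Cauchy. -/

/-! ### Convexity of cos √w and cosh √w, and hinge comparison -/

/-- `sin x / x` is nonincreasing on `(0, π]`. -/
lemma sin_div_self_le {x y : ℝ} (hx : 0 < x) (hxy : x ≤ y) (hy : y ≤ Real.pi) :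
    Real.sin y / y ≤ Real.sin x / x := by
  have hy0 : 0 < y := hx.trans_le hxy
  have h := strictConcaveOn_sin_Icc.concaveOn.2 (show y ∈ Icc 0 Real.pi from ⟨hy0.le, hy⟩)
    (show (0 : ℝ) ∈ Icc 0 Real.pi from ⟨le_rfl, Real.pi_pos.le⟩)
    (show 0 ≤ x / y by positivity)
    (show 0 ≤ 1 - x / y by rw [sub_nonneg, div_le_one hy0]; exact hxy) (by ring)
  simp only [smul_eq_mul, Real.sin_zero, mul_zero, add_zero, div_mul_cancel₀ x hy0.ne'] at h
  rw [le_div_iff₀ hx]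
  calc Real.sin y / y * x = x / y * Real.sin y := by ring
    _ ≤ _ := h

/-- `sinh x / x` is nondecreasing on `(0, ∞)`. -/
lemma sinh_div_self_le {x y : ℝ} (hx : 0 < x) (hxy : x ≤ y) :
    Real.sinh x / x ≤ Real.sinh y / y := by
  have hy0 : 0 < y := hx.trans_le hxy
  have hc : ConvexOn ℝ (Ici (0 : ℝ)) Real.sinh := by
    refine MonotoneOn.convexOn_of_deriv (convex_Ici 0) Real.continuous_sinh.continuousOn
      Real.differentiable_sinh.differentiableOn ?_
    intro a ha b hb hab
    rw [interior_Ici] at ha hb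
    rw [Real.deriv_sinh]
    exact Real.cosh_le_cosh.2 (by rwa [abs_of_pos ha, abs_of_pos hb])
  have h := hc.2 (show y ∈ Ici (0 : ℝ) from hy0.le) (self_mem_Ici (a := (0 : ℝ)))
    (show 0 ≤ x / y by positivity)
    (show 0 ≤ 1 - x / y by rw [sub_nonneg, div_le_one hy0]; exact hxy) (by ring)
  simp only [smul_eq_mul, Real.sinh_zero, mul_zero, add_zero, div_mul_cancel₀ x hy0.ne'] at h
  rw [div_le_iff₀ hx]
  calc _ ≤ _ := h
    _ = _ := by ring

lemma hasDerivAt_cos_sqrt {w : ℝ} (hw : 0 < w) :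
    HasDerivAt (fun w => Real.cos √w) (-(Real.sin √w / √w) / 2) w := by
  have h := (Real.hasDerivAt_cos √w).comp w (Real.hasDerivAt_sqrt hw.ne')
  exact h.congr_deriv (by ring)

lemma hasDerivAt_cosh_sqrt {w : ℝ} (hw : 0 < w) :
    HasDerivAt (fun w => Real.cosh √w) (Real.sinh √w / √w / 2) w := by
  have h := (Real.hasDerivAt_cosh √w).comp w (Real.hasDerivAt_sqrt hw.ne')
  exact h.congr_deriv (by ring)

/-- The derivative -sin √w / (2√w) increases as long as sin x / x decreases, which is used for √w ≤
π; hence the endpoint π². -/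
lemma convexOn_cos_sqrt : ConvexOn ℝ (Icc 0 (Real.pi ^ 2)) (fun w => Real.cos √w) := by
  refine MonotoneOn.convexOn_of_deriv (convex_Icc _ _)
    (Real.continuous_cos.comp Real.continuous_sqrt).continuousOn ?_ ?_ <;> rw [interior_Icc]
  · exact fun w hw => (hasDerivAt_cos_sqrt hw.1).differentiableAt.differentiableWithinAt
  · intro a ha b hb hab
    rw [(hasDerivAt_cos_sqrt ha.1).deriv, (hasDerivAt_cos_sqrt hb.1).deriv]
    have := sin_div_self_le (Real.sqrt_pos.2 ha.1) (Real.sqrt_le_sqrt hab)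
      (Real.sqrt_le_iff.2 ⟨Real.pi_pos.le, hb.2.le⟩)
    linarith

lemma convexOn_cosh_sqrt : ConvexOn ℝ (Ici 0) (fun w => Real.cosh √w) := by
  refine MonotoneOn.convexOn_of_deriv (convex_Ici _)
    (Real.continuous_cosh.comp Real.continuous_sqrt).continuousOn ?_ ?_ <;> rw [interior_Ici]
  · exact fun w hw => (hasDerivAt_cosh_sqrt hw).differentiableAt.differentiableWithinAt
  · intro a ha b hb hab
    rw [(hasDerivAt_cosh_sqrt ha).deriv, (hasDerivAt_cosh_sqrt hb).deriv]
    have := sinh_div_self_le (Real.sqrt_pos.2 ha) (Real.sqrt_le_sqrt hab)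
    linarith

/-- A spherical hinge is at most as wide as the Euclidean hinge with the same sides and angle. -/
lemma cos_sqrt_hinge_le {a b u : ℝ} (ha : 0 ≤ a) (hb : 0 ≤ b) (hab : a + b ≤ Real.pi)
    (hu : u ∈ Icc (-1 : ℝ) 1) :
    Real.cos √(a ^ 2 + b ^ 2 - 2 * a * b * u) ≤
      Real.cos a * Real.cos b + u * (Real.sin a * Real.sin b) := by
  have hab2 : (a + b) ^ 2 ≤ Real.pi ^ 2 := by gcongr
  -- The Euclidean squared side is affine in u and equals (a - b)² at u = 1 and (a + b)² at u = -1.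
  -- The spherical cosine is affine in u as well, with values cos (a - b) and cos (a + b) there. The
  -- claim is therefore convexity between these two points.
  have h := convexOn_cos_sqrt.2 
    (show (a - b) ^ 2 ∈ Icc 0 (Real.pi ^ 2) from
      ⟨sq_nonneg _, by nlinarith [mul_nonneg ha hb]⟩)
    (show (a + b) ^ 2 ∈ Icc 0 (Real.pi ^ 2) from ⟨sq_nonneg _, hab2⟩)
    (show 0 ≤ (1 + u) / 2 by linarith [hu.1]) (show 0 ≤ (1 - u) / 2 by linarith [hu.2]) (by ring)
  simp only [smul_eq_mul, Real.sqrt_sq_eq_abs, Real.cos_abs, Real.cos_sub, Real.cos_add] at h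
  calc _ = _ := by congr 2; ring
    _ ≤ _ := h
    _ = _ := by ring

/-- A hyperbolic hinge is at least as wide as the Euclidean hinge with the same sides and angle. -/
lemma cosh_sqrt_hinge_le {a b u : ℝ} (hu : u ∈ Icc (-1 : ℝ) 1) :
    Real.cosh √(a ^ 2 + b ^ 2 - 2 * a * b * u) ≤
      Real.cosh a * Real.cosh b - u * (Real.sinh a * Real.sinh b) := by
  have h := convexOn_cosh_sqrt.2 (mem_Ici.2 (sq_nonneg (a - b)))
    (mem_Ici.2 (sq_nonneg (a + b)))
    (show 0 ≤ (1 + u) / 2 by linarith [hu.1]) (show 0 ≤ (1 - u) / 2 by linarith [hu.2]) (by ring)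
  simp only [smul_eq_mul, Real.sqrt_sq_eq_abs, Real.cosh_abs, Real.cosh_sub, Real.cosh_add] at h
  calc _ = _ := by congr 2; ring
    _ ≤ _ := h
    _ = _ := by ring

lemma hinge_le_sq_of_cosh {a b u c : ℝ} (hu : u ∈ Icc (-1 : ℝ) 1) 
    (h : Real.cosh c = Real.cosh a * Real.cosh b - u * (Real.sinh a * Real.sinh b)) :
    a ^ 2 + b ^ 2 - 2 * a * b * u ≤ c ^ 2 := by
  have h1 := cosh_sqrt_hinge_le (a := a) (b := b) hu
  rw [← h, Real.cosh_le_cosh, abs_of_nonneg (Real.sqrt_nonneg _)] at h1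
  rw [← sq_abs c]
  exact (Real.sqrt_le_left (abs_nonneg c)).1 h1

/-- Convexity of the squared distance to a point of the sphere, at an endpoint. -/
lemma sq_sub_le_of_cos {l d r u : ℝ} (hl : 0 ≤ l) (hl' : l ≤ Real.pi / 2) (hd : 0 ≤ d)
    (hr : 0 ≤ r) (hrl : r ≤ l) (hu : 0 ≤ u)
    (h : Real.cos r = Real.cos l * Real.cos d + u * (Real.sin l * Real.sin d)) :
    l ^ 2 - 2 * l * d * u ≤ r ^ 2 := by
  have hpi := Real.pi_pos
  rcases hl.eq_or_lt with rfl | hl0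
  · nlinarith
  set w := l ^ 2 - 2 * l * d * u with hw
  have hwl : w ≤ l ^ 2 := by
    have : 0 ≤ 2 * l * d * u := by positivity
    linarith
  rcases le_or_gt w 0 with hw0 | hw0
  · nlinarith
  have hlpi : l ^ 2 ≤ Real.pi ^ 2 := by gcongr; linarith
  -- Tangent line of w ↦ cos √w at l². The choice of w turns its increment into u d sin l, which
  -- dominates u sin l sin d.
  have htan : Real.cos l + (l ^ 2 - w) * (Real.sin l / l / 2) ≤ Real.cos √w := by
    rcases hwl.eq_or_lt with he | hlt
    · rw [he, Real.sqrt_sq hl]; simp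
    have hs := convexOn_cos_sqrt.slope_le_of_hasDerivAt (x := w) (y := l ^ 2)
      ⟨hw0.le, hwl.trans hlpi⟩ ⟨by positivity, hlpi⟩ hlt (hasDerivAt_cos_sqrt (by positivity))
    rw [slope_def_field, div_le_iff₀ (by linarith), Real.sqrt_sq hl] at hs
    nlinarith
  have he : (l ^ 2 - w) * (Real.sin l / l / 2) = u * (Real.sin l * d) := by
    rw [hw]; field_simp; ring
  have hcl : 0 ≤ Real.cos l := Real.cos_nonneg_of_mem_Icc ⟨by linarith, hl'⟩
  have hsl : 0 ≤ Real.sin l := Real.sin_nonneg_of_nonneg_of_le_pi hl (by linarith)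
  have h1 : Real.cos r ≤ Real.cos √w := by
    rw [he] at htan
    refine le_trans ?_ htan
    rw [h]
    have h2 := mul_le_mul_of_nonneg_left (Real.cos_le_one d) hcl
    have h3 : u * (Real.sin l * Real.sin d) ≤ u * (Real.sin l * d) := by
      gcongr; exact Real.sin_le hd
    linarith
  have hwl' : √w ≤ l := (Real.sqrt_le_left hl).2 hwl
  have : √w ≤ r := by
    by_contra! hlt
    exact absurd h1 (not_le.2 (Real.cos_lt_cos_of_nonneg_of_le_pi hr (by linarith) hlt))
  exact (Real.sqrt_le_left hr).1 this

/-! ### Angles from the laws of cosines -/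

/-- The spherical law of cosines defines an angle. -/
lemma exists_cos_angle {l d r : ℝ} (hl : 0 ≤ l) (hl' : l ≤ Real.pi / 2) (hd : 0 ≤ d)
    (hd' : d ≤ Real.pi / 2) (hr' : r ≤ Real.pi) (h1 : l ≤ d + r) (h2 : d ≤ l + r)
    (h3 : r ≤ l + d) :
    ∃ u ∈ Icc (-1 : ℝ) 1,
      Real.cos r = Real.cos l * Real.cos d + u * (Real.sin l * Real.sin d) := by
  have hpi := Real.pi_pos
  rcases hl.eq_or_lt with rfl | hl0
  -- With a degenerate side the coefficient of u vanishes, so 0 is an arbitrary choice.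
  · exact ⟨0, by simp, by simp [show r = d by linarith]⟩
  rcases hd.eq_or_lt with rfl | hd0
  · exact ⟨0, by simp, by simp [show r = l by linarith]⟩
  have hsl := Real.sin_pos_of_pos_of_lt_pi hl0 (by linarith)
  have hsd := Real.sin_pos_of_pos_of_lt_pi hd0 (by linarith)
  have hs := mul_pos hsl hsd
  -- The triangle inequalities become cos (l + d) ≤ cos r ≤ cos (l - d), that is, -1 ≤ u ≤ 1.
  have ha : Real.cos (l + d) ≤ Real.cos r :=
    Real.cos_le_cos_of_nonneg_of_le_pi (by linarith) (by linarith) h3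
  have hb : Real.cos r ≤ Real.cos (l - d) := by
    rw [← Real.cos_abs (l - d)]
    exact Real.cos_le_cos_of_nonneg_of_le_pi (abs_nonneg _) hr'
      (abs_le.2 ⟨by linarith, by linarith⟩)
  rw [Real.cos_add] at ha
  rw [Real.cos_sub] at hb
  refine ⟨(Real.cos r - Real.cos l * Real.cos d) / (Real.sin l * Real.sin d), ⟨?_, ?_⟩, ?_⟩
  · rw [le_div_iff₀ hs]; linarith
  · rw [div_le_iff₀ hs]; linarith
  · rw [div_mul_cancel₀ _ (ne_of_gt hs)]; ring

/-- The hyperbolic law of cosines defines an angle. -/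
lemma exists_cosh_angle {l d r : ℝ} (hl : 0 ≤ l) (hd : 0 ≤ d) (h1 : l ≤ d + r) (h2 : d ≤ l + r)
    (h3 : r ≤ l + d) :
    ∃ u ∈ Icc (-1 : ℝ) 1,
      Real.cosh r = Real.cosh l * Real.cosh d - u * (Real.sinh l * Real.sinh d) := by
  rcases hl.eq_or_lt with rfl | hl0
  · exact ⟨0, by simp, by simp [show r = d by linarith]⟩
  rcases hd.eq_or_lt with rfl | hd0
  · exact ⟨0, by simp, by simp [show r = l by linarith]⟩
  have hs := mul_pos (Real.sinh_pos_iff.2 hl0) (Real.sinh_pos_iff.2 hd0)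
  have ha : Real.cosh r ≤ Real.cosh (l + d) := by
    rw [Real.cosh_le_cosh, abs_of_nonneg (by linarith), abs_of_nonneg (by linarith)]; exact h3
  have hb : Real.cosh (l - d) ≤ Real.cosh r := by
    rw [Real.cosh_le_cosh, abs_of_nonneg (a := r) (by linarith)]
    exact abs_le.2 ⟨by linarith, by linarith⟩
  rw [Real.cosh_add] at ha
  rw [Real.cosh_sub] at hb
  refine ⟨(Real.cosh l * Real.cosh d - Real.cosh r) / (Real.sinh l * Real.sinh d), ⟨?_, ?_⟩, ?_⟩
  · rw [le_div_iff₀ hs]; linarith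
  · rw [div_le_iff₀ hs]; linarith
  · rw [div_mul_cancel₀ _ (ne_of_gt hs)]; ring

/-- The Euclidean law of cosines defines an angle. -/
lemma exists_euclidean_angle {l d r : ℝ} (hl : 0 ≤ l) (hd : 0 ≤ d) (h1 : l ≤ d + r)
    (h2 : d ≤ l + r) (h3 : r ≤ l + d) :
    ∃ u ∈ Icc (-1 : ℝ) 1, r ^ 2 = l ^ 2 + d ^ 2 - 2 * l * d * u := by
  rcases hl.eq_or_lt with rfl | hl0
  · exact ⟨0, by simp, by simp [show r = d by linarith]⟩
  rcases hd.eq_or_lt with rfl | hd0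
  · exact ⟨0, by simp, by simp [show r = l by linarith]⟩
  refine ⟨(l ^ 2 + d ^ 2 - r ^ 2) / (2 * l * d), ⟨?_, ?_⟩, ?_⟩
  · rw [le_div_iff₀ (by positivity)]; nlinarith
  · rw [div_le_iff₀ (by positivity)]; nlinarith
  · field_simp; ring

lemma modelDist_comm (κ : ℝ) (u v : Fin 3 → ℝ) : modelDist κ u v = modelDist κ v u := by
  simp only [modelDist, mul_comm (u _), sub_sq_comm (u _)]

lemma modelDist_self {κ : ℝ} {u : Fin 3 → ℝ} (hu : u ∈ modelPlane κ) : modelDist κ u u = 0 := by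
  obtain ⟨h1, -, h3⟩ := hu
  unfold modelDist
  split_ifs with hp hn
  · rw [show u 0 * u 0 + u 1 * u 1 + u 2 * u 2 = 1 by linarith [h1 hp]]; simp
  · rw [show u 0 * u 0 - u 1 * u 1 - u 2 * u 2 = 1 by linarith [(h3 hn).1]]; simp
  · simp

/-! ### Explicit comparison triangles in the three geometries -/

section Comparison

variable {X : Type*} [MetricSpace X] {κ : ℝ}

/-- The CAT(`κ`) inequality between a vertex and a point of the opposite side, for an explicitly
given comparison triangle. -/
lemma IsCATSpace.dist_le_modelDist (hX : IsCATSpace κ X)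
    (hd : 0 < κ → ∀ x y : X, √κ * dist x y < Real.pi / 2) {x a y : X} {γ : ℝ → X}
    (hγ : IsGeodesic γ x a) {s : ℝ} (hs : s ∈ Icc 0 (dist x a)) {w₀ w₁ w₂ p : Fin 3 → ℝ}
    (h₀ : w₀ ∈ modelPlane κ) (h₁ : w₁ ∈ modelPlane κ) (h₂ : w₂ ∈ modelPlane κ)
    (hp : p ∈ modelPlane κ) (h₀₁ : modelDist κ w₀ w₁ = dist x a)
    (h₀₂ : modelDist κ w₀ w₂ = dist x y) (h₁₂ : modelDist κ w₁ w₂ = dist a y)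
    (hp₀ : modelDist κ w₀ p = s) (hp₁ : modelDist κ p w₁ = dist x a - s) :
    dist (γ s) y ≤ modelDist κ p w₂ := by
  have hpi := Real.pi_pos
  have hex : ∀ x y : X, ∃ γ : ℝ → X, IsGeodesic γ x y := fun x y =>
    hX.exists_geodesic x y fun hκ => by
      have := hd hκ x y
      rw [lt_div_iff₀ (Real.sqrt_pos.2 hκ)]
      linarith
  obtain ⟨γ₁, hγ₁⟩ := hex a y
  obtain ⟨γ₂, hγ₂⟩ := hex y x
  have key := hX.cat_inequality ![x, a, y] ![γ, γ₁, γ₂]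
    (by intro i; fin_cases i <;> simpa)
    (by
      intro hκ
      have hc := Real.sqrt_pos.2 hκ
      have e1 := hd hκ x a
      have e2 := hd hκ a y
      have e3 := hd hκ y x
      rw [← mul_div_assoc, lt_div_iff₀ hc]
      simp only [Matrix.cons_val]
      linarith)
    ![w₀, w₁, w₂]
    ⟨by intro i; fin_cases i <;> simpa, by
      intro i j
      fin_cases i <;> fin_cases j <;>
        simp [modelDist_self, *, modelDist_comm κ w₁ w₀, modelDist_comm κ w₂, dist_comm a x,
          dist_comm y]⟩
    -- The vertex y enters as the point at parameter 0 of the third side, which starts at y.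
    0 2 s (by simpa using hs) 0 (by simp) p w₂
    ⟨hp, by simpa using hp₀, by simpa [h₀₁] using hp₁⟩
    ⟨h₂, by simpa using modelDist_self h₂, by simp⟩
  simpa [hγ₂.1] using key

/-- Here u is the cosine of the comparison angle at x. The comparison triangle has x at the pole, a
on a fixed meridian and y at angle arccos u from it, so the CAT inequality becomes a law of cosines
with the same u. The hyperbolic and Euclidean versions below follow the same pattern. -/
lemma IsCATSpace.exists_comparison_cos (hX : IsCATSpace κ X) (hκ : 0 < κ)
    (hd : ∀ x y : X, √κ * dist x y < Real.pi / 2) {x a : X} {γ : ℝ → X}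
    (hγ : IsGeodesic γ x a) {s : ℝ} (hs : s ∈ Icc 0 (dist x a)) (y : X) :
    ∃ u ∈ Icc (-1 : ℝ) 1,
      Real.cos (√κ * dist a y) = Real.cos (√κ * dist x a) * Real.cos (√κ * dist x y) +
        u * (Real.sin (√κ * dist x a) * Real.sin (√κ * dist x y)) ∧
      Real.cos (√κ * s) * Real.cos (√κ * dist x y) +
        u * (Real.sin (√κ * s) * Real.sin (√κ * dist x y)) ≤
          Real.cos (√κ * dist (γ s) y) := by
  have hpi := Real.pi_pos
  have hc := Real.sqrt_pos.2 hκ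
  set c := √κ with hcdef
  have hl := hd x a
  have hdd := hd x y
  have hr := hd a y
  have t1 := mul_le_mul_of_nonneg_left (dist_triangle_right x a y) hc.le
  have t2 := mul_le_mul_of_nonneg_left (dist_triangle x a y) hc.le
  have t3 := mul_le_mul_of_nonneg_left (dist_triangle_left a y x) hc.le
  rw [mul_add] at t1 t2 t3
  have hl0 : 0 ≤ c * dist x a := by positivity
  have hd0 : 0 ≤ c * dist x y := by positivity
  have hr0 : 0 ≤ c * dist a y := by positivity
  have hs0 : 0 ≤ c * s := mul_nonneg hc.le hs.1
  have hsl : c * s ≤ c * dist x a := mul_le_mul_of_nonneg_left hs.2 hc.le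
  obtain ⟨u, hu, hcos⟩ := exists_cos_angle hl0 hl.le hd0 hdd.le (r := c * dist a y)
    (by linarith) t1 t2 t3
  refine ⟨u, hu, hcos, ?_⟩
  have hu2 : 0 ≤ 1 - u ^ 2 := by nlinarith [hu.1, hu.2]
  have harc : ∀ z : ℝ, 0 ≤ c * z → c * z ≤ Real.pi → Real.arccos (Real.cos (c * z)) / c = z := by
    intro z h1 h2
    rw [Real.arccos_cos h1 h2, mul_div_cancel_left₀ _ hc.ne']
  have key := hX.dist_le_modelDist (fun _ => hd) hγ hs (y := y)
    (w₀ := ![1, 0, 0]) (w₁ := ![Real.cos (c * dist x a), Real.sin (c * dist x a), 0])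
    (w₂ := ![Real.cos (c * dist x y), u * Real.sin (c * dist x y),
      √(1 - u ^ 2) * Real.sin (c * dist x y)])
    (p := ![Real.cos (c * s), Real.sin (c * s), 0])
    (by simp [modelPlane, hκ.ne', hκ.not_gt])
    (by simp [modelPlane, hκ.ne', hκ.not_gt])
    (by
      simp only [modelPlane, mem_ofPred_eq, hκ.ne', hκ.not_gt, hκ, Matrix.cons_val, false_imp_iff,
        and_true, true_imp_iff, mul_pow, Real.sq_sqrt hu2]
      linear_combination Real.sin_sq_add_cos_sq (c * dist x y))
    (by simp [modelPlane, hκ.ne', hκ.not_gt])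
    (by
      simp only [modelDist, hκ, if_true, Matrix.cons_val, ← hcdef]
      rw [one_mul, zero_mul, zero_mul, add_zero, add_zero, harc _ hl0 (by linarith)])
    (by
      simp only [modelDist, hκ, if_true, Matrix.cons_val, ← hcdef]
      rw [one_mul, zero_mul, zero_mul, add_zero, add_zero, harc _ hd0 (by linarith)])
    (by
      simp only [modelDist, hκ, if_true, Matrix.cons_val, ← hcdef]
      rw [← harc (dist a y) hr0 (by linarith), hcos]
      congr 2; ring)
    (by
      simp only [modelDist, hκ, if_true, Matrix.cons_val, ← hcdef]
      rw [one_mul, zero_mul, zero_mul, add_zero, add_zero, harc _ hs0 (by linarith)])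
    (by
      simp only [modelDist, hκ, if_true, Matrix.cons_val, ← hcdef]
      rw [← harc (dist x a - s) (by linarith) (by linarith), mul_sub, Real.cos_sub]
      congr 2; ring)
  simp only [modelDist, hκ, if_true, Matrix.cons_val, ← hcdef] at key
  rw [le_div_iff₀ hc, mul_comm] at key
  have hsd := mul_nonneg
    (Real.sin_nonneg_of_nonneg_of_le_pi hs0 (by linarith))
    (Real.sin_nonneg_of_nonneg_of_le_pi hd0 (by linarith))
  -- `arccos` can be undone only on [-1, 1]. The comparison cosine lies there because it is a convex
  -- combination of the cosines of the sum and the difference of the two sides.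
  have h1 := Real.neg_one_le_cos (c * s + c * dist x y)
  have h2 := Real.cos_le_one (c * s - c * dist x y)
  rw [Real.cos_add] at h1
  rw [Real.cos_sub] at h2
  have h3 := Real.cos_le_cos_of_nonneg_of_le_pi (by positivity) (Real.arccos_le_pi _) key
  rw [Real.cos_arccos (by nlinarith [hu.1]) (by nlinarith [hu.2])] at h3
  linarith

lemma IsCATSpace.exists_comparison_cosh (hX : IsCATSpace κ X) (hκ : κ < 0) {x a : X}
    {γ : ℝ → X} (hγ : IsGeodesic γ x a) {s : ℝ} (hs : s ∈ Icc 0 (dist x a)) (y : X) :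
    ∃ u ∈ Icc (-1 : ℝ) 1,
      Real.cosh (√(-κ) * dist a y) = Real.cosh (√(-κ) * dist x a) * Real.cosh (√(-κ) * dist x y) -
        u * (Real.sinh (√(-κ) * dist x a) * Real.sinh (√(-κ) * dist x y)) ∧
      Real.cosh (√(-κ) * dist (γ s) y) ≤ Real.cosh (√(-κ) * s) * Real.cosh (√(-κ) * dist x y) -
        u * (Real.sinh (√(-κ) * s) * Real.sinh (√(-κ) * dist x y)) := by
  have hc := Real.sqrt_pos.2 (neg_pos.2 hκ)
  set c := √(-κ) with hcdef
  have t1 := mul_le_mul_of_nonneg_left (dist_triangle_right x a y) hc.le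
  have t2 := mul_le_mul_of_nonneg_left (dist_triangle x a y) hc.le
  have t3 := mul_le_mul_of_nonneg_left (dist_triangle_left a y x) hc.le
  rw [mul_add] at t1 t2 t3
  have hl0 : 0 ≤ c * dist x a := by positivity
  have hd0 : 0 ≤ c * dist x y := by positivity
  have hr0 : 0 ≤ c * dist a y := by positivity
  have hs0 : 0 ≤ c * s := mul_nonneg hc.le hs.1
  have hsl : c * s ≤ c * dist x a := mul_le_mul_of_nonneg_left hs.2 hc.le
  obtain ⟨u, hu, hcos⟩ := exists_cosh_angle hl0 hd0 (r := c * dist a y) t1 t2 t3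
  refine ⟨u, hu, hcos, ?_⟩
  have hu2 : 0 ≤ 1 - u ^ 2 := by nlinarith [hu.1, hu.2]
  have harc : ∀ z : ℝ, 0 ≤ c * z → Real.arcosh (Real.cosh (c * z)) / c = z := by
    intro z h1
    rw [Real.arcosh_cosh h1, mul_div_cancel_left₀ _ hc.ne']
  have key := hX.dist_le_modelDist (fun h => absurd h hκ.not_gt) hγ hs (y := y)
    (w₀ := ![1, 0, 0]) (w₁ := ![Real.cosh (c * dist x a), Real.sinh (c * dist x a), 0])
    (w₂ := ![Real.cosh (c * dist x y), u * Real.sinh (c * dist x y),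
      √(1 - u ^ 2) * Real.sinh (c * dist x y)])
    (p := ![Real.cosh (c * s), Real.sinh (c * s), 0])
    (by simp [modelPlane, hκ.ne, hκ.not_gt])
    (by simp [modelPlane, hκ.ne, hκ.not_gt, Real.cosh_pos, Real.cosh_sq])
    (by
      simp only [modelPlane, mem_ofPred_eq, hκ.ne, hκ.not_gt, hκ, Matrix.cons_val, false_imp_iff,
        true_and, true_imp_iff, mul_pow, Real.sq_sqrt hu2]
      exact ⟨by linear_combination -Real.cosh_sq (c * dist x y), Real.cosh_pos _⟩)
    (by simp [modelPlane, hκ.ne, hκ.not_gt, Real.cosh_pos, Real.cosh_sq])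
    (by
      simp only [modelDist, hκ, hκ.not_gt, if_true, if_false, Matrix.cons_val, ← hcdef]
      rw [one_mul, zero_mul, zero_mul, sub_zero, sub_zero, harc _ hl0])
    (by
      simp only [modelDist, hκ, hκ.not_gt, if_true, if_false, Matrix.cons_val, ← hcdef]
      rw [one_mul, zero_mul, zero_mul, sub_zero, sub_zero, harc _ hd0])
    (by
      simp only [modelDist, hκ, hκ.not_gt, if_true, if_false, Matrix.cons_val, ← hcdef]
      rw [← harc (dist a y) hr0, hcos]
      congr 2; ring)
    (by
      simp only [modelDist, hκ, hκ.not_gt, if_true, if_false, Matrix.cons_val, ← hcdef]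
      rw [one_mul, zero_mul, zero_mul, sub_zero, sub_zero, harc _ hs0])
    (by
      simp only [modelDist, hκ, hκ.not_gt, if_true, if_false, Matrix.cons_val, ← hcdef]
      rw [← harc (dist x a - s) (by linarith), mul_sub, Real.cosh_sub]
      congr 2; ring)
  simp only [modelDist, hκ, hκ.not_gt, if_true, if_false, Matrix.cons_val, ← hcdef] at key
  rw [le_div_iff₀ hc, mul_comm] at key
  have hsd := mul_nonneg (Real.sinh_nonneg_iff.2 hs0) (Real.sinh_nonneg_iff.2 hd0)
  have h2 := Real.one_le_cosh (c * s - c * dist x y)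
  rw [Real.cosh_sub] at h2
  have h3 := Real.cosh_le_cosh.2 (abs_le_abs_of_nonneg (by positivity) key)
  rw [Real.cosh_arcosh (by nlinarith [hu.2])] at h3
  linarith

lemma IsCATSpace.exists_comparison_euclidean (hX : IsCATSpace 0 X) {x a : X}
    {γ : ℝ → X} (hγ : IsGeodesic γ x a) {s : ℝ} (hs : s ∈ Icc 0 (dist x a)) (y : X) :
    ∃ u : ℝ, dist a y ^ 2 = dist x a ^ 2 + dist x y ^ 2 - 2 * dist x a * dist x y * u ∧
      dist (γ s) y ^ 2 ≤ s ^ 2 + dist x y ^ 2 - 2 * s * dist x y * u := by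
  obtain ⟨u, hu, hcos⟩ := exists_euclidean_angle (dist_nonneg (x := x) (y := a))
    (dist_nonneg (x := x) (y := y)) (dist_triangle_right x a y) (dist_triangle x a y)
    (dist_triangle_left a y x)
  refine ⟨u, hcos, ?_⟩
  have hu2 : 0 ≤ 1 - u ^ 2 := by nlinarith [hu.1, hu.2]
  have hsq := Real.sq_sqrt hu2
  have key := hX.dist_le_modelDist (fun h => absurd h (lt_irrefl 0)) hγ hs (y := y)
    (w₀ := ![1, 0, 0]) (w₁ := ![1, dist x a, 0])
    (w₂ := ![1, u * dist x y, √(1 - u ^ 2) * dist x y])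
    (p := ![1, s, 0])
    (by simp [modelPlane]) (by simp [modelPlane]) (by simp [modelPlane]) (by simp [modelPlane])
    (by simp [modelDist])
    (by
      simp only [modelDist, lt_irrefl, if_false, Matrix.cons_val]
      rw [← Real.sqrt_sq (dist_nonneg (x := x) (y := y))]
      congr 1
      rw [Real.sqrt_sq dist_nonneg]
      linear_combination dist x y ^ 2 * hsq)
    (by
      simp only [modelDist, lt_irrefl, if_false, Matrix.cons_val]
      rw [← Real.sqrt_sq (dist_nonneg (x := a) (y := y)), hcos]
      congr 1
      linear_combination dist x y ^ 2 * hsq)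
    (by simp [modelDist, Real.sqrt_sq hs.1])
    (by
      simp only [modelDist, lt_irrefl, if_false, Matrix.cons_val]
      rw [← Real.sqrt_sq (sub_nonneg.2 hs.2)]
      congr 1
      ring)
  simp only [modelDist, lt_irrefl, if_false, Matrix.cons_val] at key
  have h2 := (Real.le_sqrt dist_nonneg (by positivity)).1 key
  refine h2.trans (le_of_eq ?_)
  linear_combination dist x y ^ 2 * hsq

end Comparison

/-! ### Convexity of distance functions along geodesics -/

/-- Strong convexity of the squared distance to a point of the hyperbolic plane. -/
lemma sq_le_of_cosh {l d r ρ u t : ℝ} (hu : u ∈ Icc (-1 : ℝ) 1)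
    (ht : t ∈ Icc (0 : ℝ) 1)
    (hr : Real.cosh r = Real.cosh l * Real.cosh d - u * (Real.sinh l * Real.sinh d))
    (hρ : Real.cosh ρ = Real.cosh (t * l) * Real.cosh d -
      u * (Real.sinh (t * l) * Real.sinh d)) :
    ρ ^ 2 ≤ (1 - t) * d ^ 2 + t * r ^ 2 - t * (1 - t) * l ^ 2 := by
  -- U is minus the derivative of cosh ρ along the geodesic. Writing U = v sinh ρ makes v the cosine
  -- of the angle at the dividing point, which splits the triangle into two hinges with opposite
  -- cosines -v and v.
  set U := u * Real.cosh (t * l) * Real.sinh d - Real.sinh (t * l) * Real.cosh d with hU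
  have hs := Real.cosh_sq (t * l)
  have hd := Real.cosh_sq d
  have hq := Real.cosh_sq ρ
  have hUle : U ^ 2 ≤ Real.sinh ρ ^ 2 := by
    have h1 : Real.cosh ρ ^ 2 - U ^ 2 = 1 + (1 - u ^ 2) * Real.sinh d ^ 2 := by
      rw [hρ, hU]
      linear_combination (Real.cosh d ^ 2 - u ^ 2 * Real.sinh d ^ 2) * hs + hd
    have h2 : 0 ≤ (1 - u ^ 2) * Real.sinh d ^ 2 :=
      mul_nonneg (by nlinarith [hu.1, hu.2]) (sq_nonneg _)
    linarith
  obtain ⟨v, hv, hvU⟩ : ∃ v ∈ Icc (-1 : ℝ) 1, U = v * Real.sinh ρ := by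
    rcases eq_or_ne (Real.sinh ρ) 0 with h0 | h0
    · refine ⟨0, by simp, ?_⟩
      rw [h0] at hUle
      nlinarith
    · refine ⟨U / Real.sinh ρ, ?_, by field_simp⟩
      rw [mem_Icc, ← abs_le, abs_div, div_le_one (abs_pos.2 h0)]
      exact sq_le_sq.1 hUle
  have e1 : Real.cosh d = Real.cosh (t * l) * Real.cosh ρ -
      -v * (Real.sinh (t * l) * Real.sinh ρ) := by
    have : Real.cosh d = Real.cosh (t * l) * Real.cosh ρ + Real.sinh (t * l) * U := by
      rw [hρ, hU]
      linear_combination -Real.cosh d * hs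
    rw [this, hvU]; ring
  have e2 : Real.cosh r = Real.cosh ((1 - t) * l) * Real.cosh ρ -
      v * (Real.sinh ((1 - t) * l) * Real.sinh ρ) := by
    have : Real.cosh r = Real.cosh ((1 - t) * l) * Real.cosh ρ - Real.sinh ((1 - t) * l) * U := by
      rw [hρ, hU, hr, show (1 - t) * l = l - t * l by ring, Real.cosh_sub, Real.sinh_sub]
      linear_combination (u * (Real.sinh l * Real.sinh d) - Real.cosh l * Real.cosh d) * hs
    rw [this, hvU]; ring
  have i1 := hinge_le_sq_of_cosh (u := -v) ⟨by linarith [hv.2], by linarith [hv.1]⟩ e1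
  have i2 := hinge_le_sq_of_cosh hv e2
  -- The weights 1 - t and t cancel the cross terms in v.
  have j1 := mul_le_mul_of_nonneg_left i1 (sub_nonneg.2 ht.2)
  have j2 := mul_le_mul_of_nonneg_left i2 ht.1
  linarith

section Convexity

variable {X : Type*} [MetricSpace X] {κ : ℝ}

/-- The inequality of Bruhat and Tits in a space of nonpositive curvature. -/
lemma IsCATSpace.dist_sq_le_of_nonpos (hX : IsCATSpace κ X) (hκ : κ ≤ 0) {x a : X}
    {γ : ℝ → X} (hγ : IsGeodesic γ x a) {t : ℝ} (ht : t ∈ Icc (0 : ℝ) 1) (y : X) :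
    dist (γ (t * dist x a)) y ^ 2 ≤
      (1 - t) * dist x y ^ 2 + t * dist a y ^ 2 - t * (1 - t) * dist x a ^ 2 := by
  have hs : t * dist x a ∈ Icc 0 (dist x a) :=
    ⟨mul_nonneg ht.1 dist_nonneg, mul_le_of_le_one_left dist_nonneg ht.2⟩
  rcases hκ.eq_or_lt with rfl | hκ
  · obtain ⟨u, h1, h2⟩ := hX.exists_comparison_euclidean hγ hs y
    refine h2.trans (le_of_eq ?_)
    linear_combination -t * h1
  · obtain ⟨u, hu, h1, h2⟩ := hX.exists_comparison_cosh hκ hγ hs y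
    have hc := Real.sqrt_pos.2 (neg_pos.2 hκ)
    set c := √(-κ)
    -- The CAT bound is at least 1, hence the cosh of a comparison distance, to which the hyperbolic
    -- identity applies exactly.
    have hQ := (Real.one_le_cosh _).trans h2
    have hρ := Real.cosh_arcosh hQ
    rw [← hρ, Real.cosh_le_cosh, abs_of_nonneg (by positivity),
      abs_of_nonneg (Real.arcosh_nonneg hQ)] at h2
    rw [mul_left_comm] at hρ h2
    have h3 := sq_le_of_cosh hu ht h1 hρ
    have h4 := (pow_le_pow_left₀ (by positivity) h2 2).trans h3
    have : 0 < c ^ 2 := by positivity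
    refine le_of_mul_le_mul_left ?_ this
    linarith

/-- One step from `x` towards `a` approaches every point `y` that is nearer to `a` than `x`. -/
lemma IsCATSpace.dist_sq_le_of_pos (hX : IsCATSpace κ X) (hκ : 0 < κ)
    (hd : ∀ x y : X, √κ * dist x y < Real.pi / 2) {x a : X} {γ : ℝ → X}
    (hγ : IsGeodesic γ x a) {t : ℝ} (ht : t ∈ Icc (0 : ℝ) 1) {y : X}
    (hy : dist a y ≤ dist x a) :
    dist (γ (t * dist x a)) y ^ 2 ≤
      dist x y ^ 2 - t * (dist x a ^ 2 - dist a y ^ 2) + t ^ 2 * dist x a ^ 2 := by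
  have hpi := Real.pi_pos
  have hs : t * dist x a ∈ Icc 0 (dist x a) :=
    ⟨mul_nonneg ht.1 dist_nonneg, mul_le_of_le_one_left dist_nonneg ht.2⟩
  obtain ⟨u, hu, h1, h2⟩ := hX.exists_comparison_cos hκ hd hγ hs y
  have hc := Real.sqrt_pos.2 hκ
  set c := √κ
  have hl := hd x a
  have hdd := hd x y
  have hz := hd (γ (t * dist x a)) y
  have hl0 : 0 ≤ c * dist x a := by positivity
  have hd0 : 0 ≤ c * dist x y := by positivity
  have hr0 : 0 ≤ c * dist a y := by positivity
  have hrl : c * dist a y ≤ c * dist x a := mul_le_mul_of_nonneg_left hy hc.le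
  have hs0 : 0 ≤ c * (t * dist x a) := mul_nonneg hc.le hs.1
  have hsl : c * (t * dist x a) ≤ c * dist x a := mul_le_mul_of_nonneg_left hs.2 hc.le
  have h3 := (cos_sqrt_hinge_le hs0 hd0 (by linarith) hu).trans h2
  have h4 : (c * dist (γ (t * dist x a)) y) ^ 2 ≤ (c * (t * dist x a)) ^ 2 +
      (c * dist x y) ^ 2 - 2 * (c * (t * dist x a)) * (c * dist x y) * u := by
    have hw : 0 ≤ (c * (t * dist x a)) ^ 2 +
        (c * dist x y) ^ 2 - 2 * (c * (t * dist x a)) * (c * dist x y) * u := by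
      have := mul_le_mul_of_nonneg_left hu.2 (mul_nonneg hs0 hd0)
      nlinarith [sq_nonneg (c * (t * dist x a) - c * dist x y)]
    refine (Real.le_sqrt (by positivity) hw).1 ?_
    by_contra! hlt
    refine absurd h3 (not_le.2 (Real.cos_lt_cos_of_nonneg_of_le_pi (Real.sqrt_nonneg _) ?_ hlt))
    linarith
  have h5 : (c * dist x a) ^ 2 - 2 * (c * dist x a) * (c * dist x y) * u ≤ (c * dist a y) ^ 2 := by
    rcases hd0.eq_or_lt with h0 | h0
    · have hxy : dist x y = 0 := by
        rcases mul_eq_zero.1 h0.symm with h | h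
        · exact absurd h hc.ne'
        · exact h
      rw [dist_eq_zero.1 hxy, dist_self, dist_comm a y]; simp
    rcases hl0.eq_or_lt with h0' | h0'
    · rw [← h0']; nlinarith
    -- The angle at x is not obtuse: the side opposite x is at most l ≤ π/2, so its cosine is at
    -- least cos l ≥ cos l cos d, which forces u ≥ 0.
    refine sq_sub_le_of_cos hl0 hl.le hd0 hr0 hrl ?_ h1
    have hsin := mul_pos (Real.sin_pos_of_pos_of_lt_pi h0' (by linarith))
      (Real.sin_pos_of_pos_of_lt_pi h0 (by linarith))
    have hcl : 0 ≤ Real.cos (c * dist x a) := Real.cos_nonneg_of_mem_Icc ⟨by linarith, hl.le⟩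
    have h6 := Real.cos_le_cos_of_nonneg_of_le_pi hr0 (by linarith) hrl
    have h7 := mul_le_mul_of_nonneg_left (Real.cos_le_one (c * dist x y)) hcl
    exact (mul_nonneg_iff_of_pos_right hsin).1 (by linarith)
  have h8 := mul_le_mul_of_nonneg_left h5 ht.1
  have : 0 < c ^ 2 := by positivity
  refine le_of_mul_le_mul_left ?_ this
  linarith

/-- Concavity of the cosine of the distance to a point along a geodesic. -/
lemma IsCATSpace.cos_dist_le_of_pos (hX : IsCATSpace κ X) (hκ : 0 < κ)
    (hd : ∀ x y : X, √κ * dist x y < Real.pi / 2) {x a : X} {γ : ℝ → X}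
    (hγ : IsGeodesic γ x a) {s : ℝ} (hs : s ∈ Icc 0 (dist x a)) (y : X) :
    Real.sin (√κ * (dist x a - s)) * Real.cos (√κ * dist x y) +
        Real.sin (√κ * s) * Real.cos (√κ * dist a y) ≤
      Real.sin (√κ * dist x a) * Real.cos (√κ * dist (γ s) y) := by
  obtain ⟨u, hu, h1, h2⟩ := hX.exists_comparison_cos hκ hd hγ hs y
  have hl := hd x a
  have hl0 : 0 ≤ √κ * dist x a := by positivity
  -- After multiplication by the sine of the whole side, the law of cosines eliminates u.
  have := mul_le_mul_of_nonneg_left h2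
    (Real.sin_nonneg_of_nonneg_of_le_pi hl0 (by linarith [Real.pi_pos]))
  rw [mul_sub, Real.sin_sub, h1]
  linarith

/-- Closed balls are convex. -/
lemma IsCATSpace.dist_le_max (hX : IsCATSpace κ X)
    (hd : 0 < κ → ∀ x y : X, √κ * dist x y < Real.pi / 2) {x a : X} {γ : ℝ → X}
    (hγ : IsGeodesic γ x a) {t : ℝ} (ht : t ∈ Icc (0 : ℝ) 1) {y : X} {R : ℝ}
    (hx : dist x y ≤ R) (ha : dist a y ≤ R) : dist (γ (t * dist x a)) y ≤ R := by
  have hR : 0 ≤ R := dist_nonneg.trans hx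
  rcases le_or_gt κ 0 with hκ | hκ
  · have h := hX.dist_sq_le_of_nonpos hκ hγ ht y
    have h1 : dist x y ^ 2 ≤ R ^ 2 := by gcongr
    have h2 : dist a y ^ 2 ≤ R ^ 2 := by gcongr
    have h3 := mul_le_mul_of_nonneg_left h1 (sub_nonneg.2 ht.2)
    have h4 := mul_le_mul_of_nonneg_left h2 ht.1
    have h5 : 0 ≤ t * (1 - t) * dist x a ^ 2 :=
      mul_nonneg (mul_nonneg ht.1 (sub_nonneg.2 ht.2)) (sq_nonneg _)
    exact abs_le_of_sq_le_sq' (by linarith) hR |>.2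
  · have hpi := Real.pi_pos
    have hd := hd hκ
    have hc := Real.sqrt_pos.2 hκ
    have hs : t * dist x a ∈ Icc 0 (dist x a) :=
      ⟨mul_nonneg ht.1 dist_nonneg, mul_le_of_le_one_left dist_nonneg ht.2⟩
    have h := hX.cos_dist_le_of_pos hκ hd hγ hs y
    rcases (dist_nonneg (x := x) (y := a)).eq_or_lt with h0 | h0
    · rw [← h0, mul_zero, hγ.1]; exact hx
    set c := √κ
    by_contra! hlt
    have hl := hd x a
    have hz := hd (γ (t * dist x a)) y
    have hl0 : 0 < c * dist x a := by positivity
    have hs0 : 0 ≤ c * (t * dist x a) := mul_nonneg hc.le hs.1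
    have hsl : c * (t * dist x a) ≤ c * dist x a := mul_le_mul_of_nonneg_left hs.2 hc.le
    set z := c * dist (γ (t * dist x a)) y
    have hzR : c * R < z := mul_lt_mul_of_pos_left hlt hc
    have hcos : ∀ p : X, dist p y ≤ R → Real.cos z < Real.cos (c * dist p y) := fun p hp =>
      Real.cos_lt_cos_of_nonneg_of_le_pi (by positivity) (by linarith)
        ((mul_le_mul_of_nonneg_left hp hc.le).trans_lt hzR)
    have hzpos : 0 < Real.cos z :=
      Real.cos_pos_of_mem_Ioo ⟨by linarith [show 0 ≤ z by positivity], hz⟩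
    have hsinl := Real.sin_pos_of_pos_of_lt_pi hl0 (by linarith)
    have hA : 0 ≤ Real.sin (c * (dist x a - t * dist x a)) :=
      Real.sin_nonneg_of_nonneg_of_le_pi (by linarith) (by linarith)
    have hB : 0 ≤ Real.sin (c * (t * dist x a)) :=
      Real.sin_nonneg_of_nonneg_of_le_pi hs0 (by linarith)
    -- The weights in the concavity inequality sum to at least the right-hand factor. If both
    -- endpoint cosines exceeded cos z > 0, that inequality would fail.
    have hsum : Real.sin (c * dist x a) ≤
        Real.sin (c * (dist x a - t * dist x a)) + Real.sin (c * (t * dist x a)) := by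
      rw [show c * dist x a = c * (dist x a - t * dist x a) + c * (t * dist x a) by ring,
        Real.sin_add]
      have e1 := mul_le_mul_of_nonneg_left (Real.cos_le_one (c * (t * dist x a))) hA
      have e2 := mul_le_mul_of_nonneg_left
        (Real.cos_le_one (c * (dist x a - t * dist x a))) hB
      linarith
    have e1 := mul_le_mul_of_nonneg_left (hcos x hx).le hA
    have e2 := mul_le_mul_of_nonneg_left (hcos a ha).le hB
    have e3 := mul_le_mul_of_nonneg_right hsum hzpos.le
    -- Strictness needs one positive weight; the first vanishes at t = 1.
    rcases hA.eq_or_lt with hA0 | hA0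
    · have hBpos : 0 < Real.sin (c * (t * dist x a)) := by linarith
      have := mul_lt_mul_of_pos_left (hcos a ha) hBpos
      linarith
    · have := mul_lt_mul_of_pos_left (hcos x hx) hA0
      linarith

end Convexity

/-! ### Furthest points and existence of the circumcentre -/

/-- A continuous function on a complete metric space that is uniformly midpoint convex and bounded
below attains its minimum. -/
lemma exists_forall_le_of_midpoint {X : Type*} [MetricSpace X] [CompleteSpace X] [Nonempty X]
    {H : X → ℝ} (hH : Continuous H) (hb : BddBelow (range H)) {c : ℝ} (hc : 0 < c)
    (hm : ∀ x y, ∃ m, c * dist x y ^ 2 ≤ H x + H y - 2 * H m) : ∃ x, ∀ y, H x ≤ H y := by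
  have hlow : ∀ y, sInf (range H) ≤ H y := fun y => csInf_le hb (mem_range_self y)
  have hex : ∀ n : ℕ, ∃ x, H x < sInf (range H) + 1 / ((n : ℝ) + 1) := fun n => by
    obtain ⟨_, ⟨x, rfl⟩, hx⟩ := exists_lt_of_csInf_lt (range_nonempty H)
      (lt_add_of_pos_right (sInf (range H)) (Nat.one_div_pos_of_nat (α := ℝ) (n := n)))
    exact ⟨x, hx⟩
  choose s hs using hex
  have hlim := tendsto_one_div_add_atTop_nhds_zero_nat (𝕜 := ℝ)
  have hcau : CauchySeq s := by
    -- If two values are within ε of the infimum, then c d² ≤ 2ε, as the midpoint value is no lower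
    -- than the infimum.
    refine cauchySeq_of_le_tendsto_0 (fun n : ℕ => √(2 / c * (1 / ((n : ℝ) + 1)))) ?_ ?_
    · intro n m K hn hm'
      obtain ⟨z, hz⟩ := hm (s n) (s m)
      have h1 := (hs n).le.trans (add_le_add_right (Nat.one_div_le_one_div (α := ℝ) hn) _)
      have h2 := (hs m).le.trans (add_le_add_right (Nat.one_div_le_one_div (α := ℝ) hm') _)
      refine Real.le_sqrt_of_sq_le ?_
      rw [div_mul_eq_mul_div, le_div_iff₀ hc]
      linarith [hlow z]
    · have := (hlim.const_mul (2 / c)).sqrt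
      simpa using this
  obtain ⟨x, hx⟩ := cauchySeq_tendsto_of_complete hcau
  refine ⟨x, fun y => le_trans ?_ (hlow y)⟩
  have h1 := (hH.tendsto x).comp hx
  have h2 := hlim.const_add (sInf (range H))
  rw [add_zero] at h2
  exact le_of_tendsto_of_tendsto' h1 h2 fun n => (hs n).le

section Enclosing

variable {X : Type*} [MetricSpace X] {κ : ℝ} {A : Set X}

lemma enclosingObjective_eq {x a : X} (h : IsFurthestPoint A x a) :
    enclosingObjective A x = dist x a ^ 2 := by
  refine IsGreatest.csSup_eq ⟨mem_image_of_mem _ h.1, ?_⟩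
  rintro _ ⟨b, hb, rfl⟩
  exact pow_le_pow_left₀ dist_nonneg (h.2 b hb) 2

/-- A maximum of 1-Lipschitz functions is 1-Lipschitz. -/
lemma continuous_dist_furthest {f : X → X} (hf : ∀ x, IsFurthestPoint A x (f x)) :
    Continuous fun x => dist x (f x) := by
  refine (LipschitzWith.of_le_add fun x y => ?_).continuous
  linarith [dist_triangle x y (f x), (hf y).2 _ (hf x).1]

lemma mul_dist_lt_pi_div_two (hκ : 0 < κ)
    (hdiam : Bornology.IsBounded (univ : Set X) ∧
      Metric.diam (univ : Set X) < Real.pi / (2 * √κ)) (x y : X) :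
    √κ * dist x y < Real.pi / 2 := by
  have hc := Real.sqrt_pos.2 hκ
  have h := (Metric.dist_le_diam_of_mem hdiam.1 (mem_univ x) (mem_univ y)).trans_lt hdiam.2
  rw [lt_div_iff₀ (by positivity)] at h
  linarith

/-- The circumcentre of `A` exists. -/
lemma IsCATSpace.exists_dist_furthest_le [CompleteSpace X] [Nonempty X] (hX : IsCATSpace κ X)
    (hdiam : 0 < κ → Bornology.IsBounded (univ : Set X) ∧
      Metric.diam (univ : Set X) < Real.pi / (2 * √κ))
    {f : X → X} (hf : ∀ x, IsFurthestPoint A x (f x)) :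
    ∃ p, ∀ y, dist p (f p) ≤ dist y (f y) := by
  have hR := continuous_dist_furthest hf
  have hhalf : (1 / 2 : ℝ) ∈ Icc (0 : ℝ) 1 := by constructor <;> norm_num
  rcases le_or_gt κ 0 with hκ | hκ
  · obtain ⟨p, hp⟩ := exists_forall_le_of_midpoint (H := fun x => dist x (f x) ^ 2) (hR.pow 2)
      ⟨0, by rintro _ ⟨x, rfl⟩; positivity⟩ (c := 1 / 2) (by norm_num) (by
        intro x y
        obtain ⟨γ, hγ⟩ := hX.exists_geodesic x y fun h => absurd h hκ.not_gt
        refine ⟨γ (1 / 2 * dist x y), ?_⟩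
        -- All three distances are tested against one furthest point of the midpoint, which can only
        -- underestimate the values at x and y.
        have h := hX.dist_sq_le_of_nonpos hκ hγ hhalf (f (γ (1 / 2 * dist x y)))
        have hx := pow_le_pow_left₀ dist_nonneg ((hf x).2 _ (hf (γ (1 / 2 * dist x y))).1) 2
        have hy := pow_le_pow_left₀ dist_nonneg ((hf y).2 _ (hf (γ (1 / 2 * dist x y))).1) 2
        linarith)
    exact ⟨p, fun y => abs_le_of_sq_le_sq' (hp y) dist_nonneg |>.2⟩
  · have hpi := Real.pi_pos
    have hd := mul_dist_lt_pi_div_two hκ (hdiam hκ)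
    have hc := Real.sqrt_pos.2 hκ
    set c := √κ
    have hD : c * Metric.diam (univ : Set X) < Real.pi / 2 := by
      have := (hdiam hκ).2
      rw [lt_div_iff₀ (by positivity)] at this
      linarith
    have hD0 : 0 ≤ c * Metric.diam (univ : Set X) := mul_nonneg hc.le Metric.diam_nonneg
    set g := Real.cos (c * Metric.diam (univ : Set X))
    have hg : 0 < g := Real.cos_pos_of_mem_Ioo ⟨by linarith, hD⟩
    obtain ⟨p, hp⟩ := exists_forall_le_of_midpoint (H := fun x => -Real.cos (c * dist x (f x)))
      (Real.continuous_cos.comp (hR.const_mul c)).neg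
      ⟨-1, by rintro _ ⟨x, rfl⟩; exact neg_le_neg (Real.cos_le_one _)⟩
      -- The modulus comes from 1 - cos θ ≥ 2θ²/π² at half the rescaled distance, multiplied by the
      -- lower bound g for the cosine at the midpoint. The strict diameter bound makes g positive.
      (c := g * c ^ 2 / Real.pi ^ 2) (by positivity) (by
        intro x y
        rcases (dist_nonneg (x := x) (y := y)).eq_or_lt with h0 | h0
        · refine ⟨x, ?_⟩
          rw [dist_eq_zero.1 h0.symm]
          simp only [dist_self]
          linarith
        have hl := hd x y
        have hl0 : 0 < c * dist x y := by positivity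
        obtain ⟨γ, hγ⟩ := hX.exists_geodesic x y fun _ => by rw [lt_div_iff₀ hc]; linarith
        set m := γ (1 / 2 * dist x y)
        refine ⟨m, ?_⟩
        have h := hX.cos_dist_le_of_pos hκ hd hγ (s := 1 / 2 * dist x y)
          ⟨by positivity, by linarith⟩ (f m)
        change _ ≤ Real.sin (c * dist x y) * Real.cos (c * dist m (f m)) at h
        have hle : ∀ z, Real.cos (c * dist z (f z)) ≤ Real.cos (c * dist z (f m)) := fun z =>
          Real.cos_le_cos_of_nonneg_of_le_pi (by positivity) (by linarith [hd z (f z)])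
            (mul_le_mul_of_nonneg_left ((hf z).2 _ (hf m).1) hc.le)
        have hG : g ≤ Real.cos (c * dist m (f m)) :=
          Real.cos_le_cos_of_nonneg_of_le_pi (by positivity) (by linarith)
            (mul_le_mul_of_nonneg_left
              (Metric.dist_le_diam_of_mem (hdiam hκ).1 (mem_univ _) (mem_univ _)) hc.le)
        have hsin : 0 < Real.sin (c * dist x y / 2) :=
          Real.sin_pos_of_pos_of_lt_pi (by linarith) (by linarith)
        rw [show c * dist x y = 2 * (c * dist x y / 2) by ring, Real.sin_two_mul,
          show c * (dist x y - 1 / 2 * dist x y) = c * dist x y / 2 by ring,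
          show c * (1 / 2 * dist x y) = c * dist x y / 2 by ring] at h
        have h1 : Real.cos (c * dist x (f m)) + Real.cos (c * dist y (f m)) ≤
            2 * Real.cos (c * dist x y / 2) * Real.cos (c * dist m (f m)) :=
          le_of_mul_le_mul_left (by linarith) hsin
        have h2 := Real.cos_le_one_sub_mul_cos_sq (x := c * dist x y / 2)
          (by rw [abs_of_pos (by linarith)]; linarith)
        have h3 := mul_le_mul_of_nonneg_left h2 (hg.le.trans hG)
        have h4 : g * (2 / Real.pi ^ 2 * (c * dist x y / 2) ^ 2) ≤
            Real.cos (c * dist m (f m)) * (2 / Real.pi ^ 2 * (c * dist x y / 2) ^ 2) :=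
          mul_le_mul_of_nonneg_right hG (by positivity)
        have h5 : g * c ^ 2 / Real.pi ^ 2 * dist x y ^ 2 =
            2 * (g * (2 / Real.pi ^ 2 * (c * dist x y / 2) ^ 2)) := by ring
        rw [h5]
        linarith [hle x, hle y])
    refine ⟨p, fun y => ?_⟩
    by_contra! hlt
    refine absurd (neg_le_neg_iff.1 (hp y)) (not_le.2 ?_)
    exact Real.cos_lt_cos_of_nonneg_of_le_pi (by positivity) (by linarith [hd p (f p)])
      (mul_lt_mul_of_pos_left hlt hc)

/-! ### The step estimate and the rate of convergence -/

/-- One step from `x` towards `a` approaches every point `y` that is nearer to `a` than `x`. -/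
lemma IsCATSpace.dist_sq_step_le (hX : IsCATSpace κ X)
    (hd : 0 < κ → ∀ x y : X, √κ * dist x y < Real.pi / 2) {x a : X} {γ : ℝ → X}
    (hγ : IsGeodesic γ x a) {t : ℝ} (ht : t ∈ Icc (0 : ℝ) 1) {y : X}
    (hy : dist a y ≤ dist x a) :
    dist (γ (t * dist x a)) y ^ 2 ≤
      dist x y ^ 2 - t * (dist x a ^ 2 - dist a y ^ 2) + t ^ 2 * dist x a ^ 2 := by
  rcases le_or_gt κ 0 with hκ | hκ
  · have h := hX.dist_sq_le_of_nonpos hκ hγ ht y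
    have := mul_nonneg ht.1 (sq_nonneg (dist x y))
    linarith
  · exact hX.dist_sq_le_of_pos hκ (hd hκ) hγ ht hy

end Enclosing

theorem theorem2 {X : Type*} [MetricSpace X] [CompleteSpace X] (κ : ℝ)
    (hX : IsCATSpace κ X)
    (hdiam : 0 < κ → Bornology.IsBounded (Set.univ : Set X) ∧
      Metric.diam (Set.univ : Set X) < Real.pi / (2 * √κ))
    (A : Set X) (hA : Bornology.IsBounded A)
    (hfar : ∀ x : X, ∃ a : X, IsFurthestPoint A x a)
    (N : ℕ) (x : ℕ → X)
    (hx : IsAlgorithmRun A (fun _ => 1 / √(2 * ((N : ℝ) + 1))) N x) :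
    ∃ m : ℝ, IsLeast (Set.range (enclosingObjective A)) m ∧
      (Finset.range (N + 1)).inf' Finset.nonempty_range_add_one
          (fun k => enclosingObjective A (x k)) - m ≤
        2 * √2 * Metric.diam A ^ 2 / √((N : ℝ) + 1) := by
  have : Nonempty X := ⟨x 0⟩
  have hd : 0 < κ → ∀ x y : X, √κ * dist x y < Real.pi / 2 := fun hκ =>
    mul_dist_lt_pi_div_two hκ (hdiam hκ)
  choose f hf using hfar
  have hF : ∀ y, enclosingObjective A y = dist y (f y) ^ 2 := fun y => enclosingObjective_eq (hf y)
  obtain ⟨p, hp⟩ := hX.exists_dist_furthest_le hdiam hf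
  refine ⟨enclosingObjective A p, ⟨mem_range_self p, ?_⟩, ?_⟩
  · rintro _ ⟨y, rfl⟩
    rw [hF, hF]
    exact pow_le_pow_left₀ dist_nonneg (hp y) 2
  set M := (Finset.range (N + 1)).inf' Finset.nonempty_range_add_one
    (fun k => enclosingObjective A (x k)) - enclosingObjective A p with hM
  set D := Metric.diam A
  set t := 1 / √(2 * ((N : ℝ) + 1)) with htdef
  have hN : (0 : ℝ) ≤ N := N.cast_nonneg
  have hsqrt : 1 ≤ √(2 * ((N : ℝ) + 1)) := Real.one_le_sqrt.2 (by linarith)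
  have ht : t ∈ Icc (0 : ℝ) 1 :=
    ⟨by positivity, by rw [htdef, div_le_one (by linarith)]; exact hsqrt⟩
  obtain ⟨hx0, hrun⟩ := hx
  have hball : ∀ k ≤ N, ∀ b ∈ A, dist (x k) b ≤ D := by
    intro k
    induction k with
    | zero => exact fun _ b hb => Metric.dist_le_diam_of_mem hA hx0 hb
    | succ k ih =>
      intro hk b hb
      obtain ⟨a, ha, γ, hγ, he⟩ := hrun k hk
      rw [he]
      exact hX.dist_le_max hd hγ ht (ih (by omega) b hb) (Metric.dist_le_diam_of_mem hA ha.1 hb)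
  -- The geodesic is arbitrary and k = N is allowed, so the estimate also covers one extra step
  -- beyond the run.
  have hstep : ∀ k ≤ N, ∀ a, IsFurthestPoint A (x k) a → ∀ γ, IsGeodesic γ (x k) a →
      t * M + dist (γ (t * dist (x k) a)) p ^ 2 ≤ dist (x k) p ^ 2 + t ^ 2 * D ^ 2 := by
    intro k hk a ha γ hγ
    have hap : dist a p ≤ dist p (f p) := by rw [dist_comm]; exact (hf p).2 a ha.1
    have h1 := hX.dist_sq_step_le hd hγ ht
      (hap.trans ((hp (x k)).trans (ha.2 _ (hf (x k)).1)))
    have hMk : M ≤ dist (x k) a ^ 2 - dist a p ^ 2 := by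
      have e1 := Finset.inf'_le (fun k => enclosingObjective A (x k))
        (Finset.mem_range.2 (Nat.lt_succ_of_le hk))
      rw [enclosingObjective_eq ha] at e1
      have e2 := pow_le_pow_left₀ dist_nonneg hap 2
      rw [hM, hF p]
      linarith
    have h2 := mul_le_mul_of_nonneg_left hMk ht.1
    have h3 := mul_le_mul_of_nonneg_left
      (pow_le_pow_left₀ dist_nonneg (hball k hk a ha.1) 2) (sq_nonneg t)
    linarith
  have hsum : ∀ k ≤ N, k * (t * M) + dist (x k) p ^ 2 ≤ D ^ 2 + k * (t ^ 2 * D ^ 2) := by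
    intro k
    induction k with
    | zero =>
      intro _
      have h1 : dist (x 0) p ≤ D := calc
        dist (x 0) p ≤ dist p (f p) := by rw [dist_comm]; exact (hf p).2 _ hx0
        _ ≤ dist (x 0) (f (x 0)) := hp _
        _ ≤ D := hball 0 (Nat.zero_le _) _ (hf _).1
      have := pow_le_pow_left₀ dist_nonneg h1 2
      simpa using this
    | succ k ih =>
      intro hk
      obtain ⟨a, ha, γ, hγ, he⟩ := hrun k hk
      have h1 := hstep k (by omega) a ha γ hγ
      have h2 := ih (by omega)
      rw [he]
      push_cast
      linarith
  have htotal : ((N : ℝ) + 1) * (t * M) ≤ D ^ 2 + ((N : ℝ) + 1) * (t ^ 2 * D ^ 2) := by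
    -- A fictitious step from the last iterate supplies the (N+1)-st term of the sum; the squared
    -- distance it leaves is discarded.
    obtain ⟨γ, hγ⟩ := hX.exists_geodesic (x N) (f (x N)) fun hκ => by
      rw [lt_div_iff₀ (Real.sqrt_pos.2 hκ)]
      linarith [hd hκ (x N) (f (x N)), Real.pi_pos]
    have h1 := hstep N le_rfl _ (hf _) γ hγ
    have h2 := hsum N le_rfl
    have h3 := sq_nonneg (dist (γ (t * dist (x N) (f (x N)))) p)
    linarith
  have hN1 : (0 : ℝ) < (N : ℝ) + 1 := by linarith
  have hS := Real.sqrt_pos.2 hN1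
  have hSsq := Real.sq_sqrt hN1.le
  have h2 : (0 : ℝ) < √2 := by positivity
  have h2sq : √2 ^ 2 = (2 : ℝ) := Real.sq_sqrt (by norm_num)
  rw [Real.sqrt_mul (by norm_num)] at htdef
  set S := √((N : ℝ) + 1)
  rw [← hSsq, htdef] at htotal
  have e1 : S ^ 2 * (1 / (√2 * S) * M) = S * M / √2 := by field_simp
  have e2 : S ^ 2 * ((1 / (√2 * S)) ^ 2 * D ^ 2) = D ^ 2 / 2 := by
    field_simp; rw [h2sq]; ring
  rw [e1, e2, div_le_iff₀ h2] at htotal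
  rw [le_div_iff₀ hS]
  have : 0 ≤ √2 * D ^ 2 := by positivity
  linarith
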